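/- Let $G$ be a compact (Hausdorff) abelian group with discrete dual group $\Gamma$, written multiplicatively. For an integer $N\ge 1$, a set $E\subseteq\Gamma$ is called $N$-pseudo-Rademacher ($N$-PR) if for every function $\varphi$ from $E$ to the group of $N$-th roots of unity there is $x\in G$ with $\varphi(\gamma)=\gamma(x)$ for all $\gamma\in E$; a subset of any discrete abelian group is $N$-PR if it is so when that group is viewed as the dual of its (compact) dual group. For a prime $p$ and an integer $k\ge 1$, let $\Gamma_{p^k}$ be the subgroup of those elements of $\Gamma$ that have finite order not divisible by $p^k$, and let $\pi_{p^k}:\Gamma\to\Gamma/\Gamma_{p^k}$ be the quotient map. Let $E\subseteq\Gamma$, let $n\ge 1$ be an integer and let $p$ be a prime. The following are equivalent: 1. $E$ is $p^n$-PR. 2. For all $1\le k\le n$, the set $\pi_{p^k}(E)$ is $p^{n+1-k}$-PR (as a subset of $\Gamma/\Gamma_{p^k}$) and $\pi_{p^k}$ is one-to-one on $E$. 3. For some $1\le k\le n$, the set $\pi_{p^k}(E)$ is $p^{n+1-k}$-PR (as a subset of $\Gamma/\Gamma_{p^k}$) and $\pi_{p^k}$ is one-to-one on $E$. -/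

import Mathlib

namespace PseudoRademacher

/-- Let `G` be a (compact abelian) group with dual group `PontryaginDual G`. A set `E` of characters
of `G` is `N`-pseudo-Rademacher (`N`-PR) if every function from `E` to the `N`-th roots of unity in
the circle is the evaluation at some point of `G`. -/
def IsPR {G : Type*} [CommGroup G] [TopologicalSpace G] (N : ℕ)
    (E : Set (PontryaginDual G)) : Prop :=
  ∀ φ : E → Circle, (∀ γ, φ γ ^ N = 1) →
    ∃ x : G, ∀ γ : E, φ γ = (γ : PontryaginDual G) x

/-- The canonical (evaluation) map of an abelian group `Γ` into the dual of its dual group: `γ` is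
viewed as the character `x ↦ x γ` of the dual group of `Γ`. For a discrete `Γ`, the dual group is a
compact group, and this map is the usual identification of `Γ` with the dual of that group. -/
noncomputable def evalChar (Γ : Type*) [CommGroup Γ] [TopologicalSpace Γ] (γ : Γ) :
    PontryaginDual (PontryaginDual Γ) :=
  ({ toFun := fun x : PontryaginDual Γ => x γ
     map_one' := rfl
     map_mul' := fun _ _ => rfl
     continuous_toFun := ContinuousEvalConst.continuous_eval_const (F := Γ →ₜ* Circle) γ } :
    PontryaginDual Γ →ₜ* Circle)

/-- A subset `E` of a discrete abelian group `Γ` is `N`-PR if it is so as a set of characters of the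
compact group `PontryaginDual Γ`, whose dual group is `Γ`. -/
def IsPRInDiscrete {Γ : Type*} [CommGroup Γ] [TopologicalSpace Γ] [DiscreteTopology Γ] (N : ℕ)
    (E : Set Γ) : Prop :=
  IsPR N (evalChar Γ '' E)

/-- For a prime `p` and `k ≥ 1`, the subgroup of the elements of the abelian group `Γ` that have
finite order not divisible by `p ^ k`. -/
def primePowSubgroup (Γ : Type*) [CommGroup Γ] (p k : ℕ) (hp : p.Prime) (hk : 1 ≤ k) :
    Subgroup Γ where
  carrier := {γ | IsOfFinOrder γ ∧ ¬ p ^ k ∣ orderOf γ}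
  one_mem' := by
    refine ⟨IsOfFinOrder.one, ?_⟩
    rw [orderOf_one, Nat.dvd_one, Nat.pow_eq_one]
    have := hp.one_lt
    omega
  mul_mem' := by
    rintro a b ⟨ha, ha'⟩ ⟨hb, hb'⟩
    refine ⟨ha.mul hb, fun h => ?_⟩
    have h1 := h.trans (Commute.all a b).orderOf_mul_dvd_lcm
    have ha0 : orderOf a ≠ 0 := ha.orderOf_pos.ne'
    have hb0 : orderOf b ≠ 0 := hb.orderOf_pos.ne'
    rw [hp.pow_dvd_iff_le_factorization (Nat.lcm_ne_zero ha0 hb0),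
      Nat.factorization_lcm ha0 hb0, Finsupp.sup_apply, le_sup_iff,
      ← hp.pow_dvd_iff_le_factorization ha0, ← hp.pow_dvd_iff_le_factorization hb0] at h1
    exact h1.elim ha' hb'
  inv_mem' := by
    rintro a ⟨ha, ha'⟩
    exact ⟨ha.inv, by rwa [orderOf_inv]⟩

/-- A quotient of a discrete group, with the quotient topology, is discrete. -/
instance instDiscreteTopologyQuotient {Γ : Type*} [CommGroup Γ] [TopologicalSpace Γ]
    [DiscreteTopology Γ] (L : Subgroup Γ) : DiscreteTopology (Γ ⧸ L) :=
  discreteTopology_iff_forall_isOpen.mpr fun s =>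
    (QuotientGroup.isQuotientMap_mk (N := L)).isOpen_preimage.mp
      (isOpen_discrete (QuotientGroup.mk ⁻¹' s))

/-- The quotient map `π_{p^k}` of `Γ` modulo the subgroup of the elements of finite order not
divisible by `p ^ k`. -/
def primePowProj (Γ : Type*) [CommGroup Γ] (p k : ℕ) (hp : p.Prime) (hk : 1 ≤ k) :
    Γ →* Γ ⧸ primePowSubgroup Γ p k hp hk :=
  QuotientGroup.mk' (primePowSubgroup Γ p k hp hk)

end PseudoRademacher

/-! For N ≥ 1, a set of characters of a compact abelian group is N-PR iff in every multiplicative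
relation among its members all exponents are divisible by N (`isPR_iff_relationsDivisible`).
Necessity is tested with a primitive N-th root of unity; sufficiency is a Haar measure argument
(`exists_forall_eq_apply`). As discrete groups embed in their biduals, the theorem becomes algebra.
If ∏ γ^m(γ) has finite order o with p^k ∤ o, its o-th power is a relation, so p^n ∣ o·m(γ) and
p^(n+1-k) ∣ m(γ). Conversely, if p^j, j < k, divides all exponents of a relation, dividing them by
p^j leaves an element killed by π_{p^k}, which yields a further factor p^(n+1-k); iterating up to j
= k-1 gives p^n. -/

namespace PseudoRademacher

open MeasureTheory

/-! ### Divisibility of exponents in relations -/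

section Relations

variable {ι κ A B : Type*} [CommGroup A] [CommGroup B]

/-- The homomorphism `m ↦ ∏ i, f i ^ m i` attached to a family `f` of elements of an abelian
group, written additively. -/
noncomputable def monomial (f : ι → A) : (ι →₀ ℤ) →ₗ[ℤ] Additive A :=
  Finsupp.linearCombination ℤ fun i => Additive.ofMul (f i)

theorem monomial_single (f : ι → A) (i : ι) (k : ℤ) :
    (monomial f (Finsupp.single i k)).toMul = f i ^ k := by
  simp [monomial]

theorem map_monomial (g : A →* B) (f : ι → A) (m : ι →₀ ℤ) :
    g (monomial f m).toMul = (monomial (fun i => g (f i)) m).toMul := by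
  have h := Finsupp.apply_linearCombination ℤ (MonoidHom.toAdditive g).toIntLinearMap
    (fun i => Additive.ofMul (f i)) m
  exact congrArg Additive.toMul h

theorem monomial_mul (f g : ι → A) (m : ι →₀ ℤ) :
    monomial (fun i => f i * g i) m = monomial f m + monomial g m := by
  simp [monomial, Finsupp.linearCombination_apply, Finsupp.sum, Finset.sum_add_distrib]

theorem monomial_eq_zero_of_pow {N : ℕ} {f : ι → A} (hf : ∀ i, f i ^ N = 1) {m : ι →₀ ℤ}
    (hm : ∀ i, (N : ℤ) ∣ m i) : monomial f m = 0 := by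
  rw [monomial, Finsupp.linearCombination_apply]
  refine Finset.sum_eq_zero fun i _ => ?_
  obtain ⟨c, hc⟩ := hm i
  change Additive.ofMul (f i ^ m i) = 0
  rw [hc, zpow_mul, zpow_natCast, hf, one_zpow, ofMul_one]

/-- All exponents occurring in multiplicative relations among the members of `f` are divisible
by `N`. -/
def RelationsDivisible (N : ℕ) (f : ι → A) : Prop :=
  ∀ m : ι →₀ ℤ, monomial f m = 0 → ∀ i, (N : ℤ) ∣ m i

theorem relationsDivisible_comp_hom {N : ℕ} {f : ι → A} (g : A →* B)
    (hg : Function.Injective g) :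
    RelationsDivisible N (fun i => g (f i)) ↔ RelationsDivisible N f := by
  refine forall_congr' fun m => imp_congr_left ?_
  have h : g (monomial f m).toMul = 1 ↔ (monomial f m).toMul = 1 :=
    map_eq_one_iff g hg
  rw [map_monomial] at h
  exact h

theorem RelationsDivisible.comp_equiv {N : ℕ} {f : ι → A} (h : RelationsDivisible N f)
    (e : κ ≃ ι) : RelationsDivisible N (fun k => f (e k)) := by
  intro m hm k
  have h' := h (Finsupp.mapDomain e m) (by
    rw [monomial, Finsupp.linearCombination_mapDomain]; exact hm) (e k)
  rwa [Finsupp.mapDomain_apply e.injective] at h'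

theorem relationsDivisible_comp_equiv {N : ℕ} {f : ι → A} (e : κ ≃ ι) :
    RelationsDivisible N (fun k => f (e k)) ↔ RelationsDivisible N f :=
  ⟨fun h => by simpa using h.comp_equiv e.symm, fun h => h.comp_equiv e⟩

/-- A coincidence `f i = f j` with `i ≠ j` is a relation with exponents 1 and -1. -/
theorem RelationsDivisible.injective {N : ℕ} {f : ι → A} (h : RelationsDivisible N f)
    (hN : N ≠ 1) : Function.Injective f := by
  classical
  intro i j hij
  by_contra hne
  have h' := h (Finsupp.single i 1 - Finsupp.single j 1)
    (by simp [monomial, hij]) i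
  rw [Finsupp.sub_apply, Finsupp.single_eq_same, Finsupp.single_eq_of_ne hne, sub_zero] at h'
  exact hN (Nat.dvd_one.mp (by exact_mod_cast h'))

theorem mem_primePowSubgroup_of_pow_eq_one {p k : ℕ} (hp : p.Prime) (hk : 1 ≤ k) {a : A} {j : ℕ}
    (hj : j < k) (ha : a ^ p ^ j = 1) : a ∈ primePowSubgroup A p k hp hk := by
  refine ⟨isOfFinOrder_iff_pow_eq_one.mpr ⟨_, pow_pos hp.pos _, ha⟩, fun h => ?_⟩
  have := (Nat.pow_dvd_pow_iff_le_right hp.one_lt).mp (h.trans (orderOf_dvd_of_pow_eq_one ha))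
  omega

theorem monomial_primePowProj_eq_zero {p k : ℕ} {hp : p.Prime} {hk : 1 ≤ k} {f : ι → A}
    {m : ι →₀ ℤ} :
    monomial (fun i => primePowProj A p k hp hk (f i)) m = 0 ↔
      (monomial f m).toMul ∈ primePowSubgroup A p k hp hk := by
  refine Iff.trans ?_
    (QuotientGroup.eq_one_iff (N := primePowSubgroup A p k hp hk) (monomial f m).toMul)
  exact iff_of_eq (congrArg (· = 1) (map_monomial (primePowProj A p k hp hk) f m).symm)

theorem pow_dvd_of_pow_dvd_mul_of_not_pow_dvd {p k n o : ℕ} (hp : p.Prime) (ho : ¬ p ^ k ∣ o)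
    {a : ℤ} (h : ((p ^ n : ℕ) : ℤ) ∣ o * a) : ((p ^ (n + 1 - k) : ℕ) : ℤ) ∣ a := by
  rcases eq_or_ne a 0 with rfl | ha
  · exact dvd_zero _
  have ho0 : o ≠ 0 := by rintro rfl; exact ho (dvd_zero _)
  have ha0 : a.natAbs ≠ 0 := Int.natAbs_ne_zero.mpr ha
  rw [Int.natCast_dvd, Int.natAbs_mul, Int.natAbs_natCast,
    hp.pow_dvd_iff_le_factorization (mul_ne_zero ho0 ha0),
    Nat.factorization_mul ho0 ha0, Finsupp.add_apply] at h
  rw [hp.pow_dvd_iff_le_factorization ho0] at ho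
  rw [Int.natCast_dvd, hp.pow_dvd_iff_le_factorization ha0]
  omega

theorem RelationsDivisible.comp_primePowProj {p n k : ℕ} {f : ι → A}
    (h : RelationsDivisible (p ^ n) f) (hp : p.Prime) (hk : 1 ≤ k) :
    RelationsDivisible (p ^ (n + 1 - k)) (fun i => primePowProj A p k hp hk (f i)) := by
  intro m hm i
  rw [monomial_primePowProj_eq_zero] at hm
  have h1 : monomial f (orderOf (monomial f m).toMul • m) = 0 := by
    rw [map_nsmul]
    exact pow_orderOf_eq_one (monomial f m).toMul
  have h2 := h _ h1 i
  rw [Finsupp.smul_apply, nsmul_eq_mul] at h2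
  exact pow_dvd_of_pow_dvd_mul_of_not_pow_dvd hp hm.2 h2

theorem RelationsDivisible.of_comp_primePowProj {p n k : ℕ} {f : ι → A} (hp : p.Prime) (hk : 1 ≤ k)
    (hkn : k ≤ n)
    (h : RelationsDivisible (p ^ (n + 1 - k)) (fun i => primePowProj A p k hp hk (f i))) :
    RelationsDivisible (p ^ n) f := by
  intro m hm
  have key : ∀ j, j < k → (∀ i, ((p ^ j : ℕ) : ℤ) ∣ m i) →
      ∀ i, ((p ^ (j + (n + 1 - k)) : ℕ) : ℤ) ∣ m i := by
    intro j hj hdvd i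
    obtain ⟨m', rfl⟩ : ∃ m' : ι →₀ ℤ, m = p ^ j • m' := by
      refine ⟨m.mapRange (fun a => a / ((p ^ j : ℕ) : ℤ)) (by simp), ?_⟩
      ext i
      rw [Finsupp.smul_apply, Finsupp.mapRange_apply, nsmul_eq_mul, Int.mul_ediv_cancel' (hdvd i)]
    have hmem : (monomial f m').toMul ∈ primePowSubgroup A p k hp hk := by
      refine mem_primePowSubgroup_of_pow_eq_one hp hk hj ?_
      rw [map_nsmul] at hm
      exact hm
    have h1 := h m' (monomial_primePowProj_eq_zero.mpr hmem) i
    rw [Finsupp.smul_apply, nsmul_eq_mul, pow_add, Nat.cast_mul]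
    exact mul_dvd_mul_left _ h1
  have hall : ∀ j, j < k → ∀ i, ((p ^ j : ℕ) : ℤ) ∣ m i := by
    intro j
    induction j with
    | zero => intro _ i; simp
    | succ j ih =>
      intro hj i
      -- Since `k ≤ n`, each round gains at least one factor of `p`.
      refine dvd_trans ?_ (key j (by omega) (ih (by omega)) i)
      exact_mod_cast pow_dvd_pow p (by omega)
  have := key (k - 1) (by omega) (hall (k - 1) (by omega))
  rwa [show k - 1 + (n + 1 - k) = n by omega] at this

end Relations

theorem relationsDivisible_image {A B : Type*} [CommGroup B] {N : ℕ} {E : Set A} {g : A → B} (hg : Set.InjOn g E) :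
    RelationsDivisible N (Subtype.val : g '' E → B) ↔
      RelationsDivisible N (fun a : E => g a) :=
  (relationsDivisible_comp_equiv (Equiv.Set.imageOfInjOn g E hg)).symm

/-! ### Solving character equations on compact groups -/

section Compact

variable {ι G : Type*} [CommGroup G] [TopologicalSpace G]

theorem monomial_dual_apply (f : ι → PontryaginDual G) (m : ι →₀ ℤ) (x : G) :
    (monomial f m).toMul x = (monomial (fun i => f i x) m).toMul :=
  map_monomial (A := PontryaginDual G) (B := Circle)
    { toFun := fun γ => γ x, map_one' := rfl, map_mul' := fun _ _ => rfl } f m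

theorem continuous_monomial_circle (m : ι →₀ ℤ) :
    Continuous fun y : ι → Circle => (monomial y m).toMul := by
  have h : (fun y : ι → Circle => (monomial y m).toMul) =
      fun y => ∏ i ∈ m.support, y i ^ m i := by
    funext y
    simp [monomial, Finsupp.linearCombination_apply, Finsupp.sum, toMul_sum]
  rw [h]
  fun_prop

/-- The character `y ↦ ∏ i, y i ^ m i` of a product of circles, as a complex function. -/
noncomputable def monomialFun (m : ι →₀ ℤ) : C(ι → Circle, ℂ) where
  toFun y := ((monomial y m).toMul : Circle)
  continuous_toFun := continuous_subtype_val.comp (continuous_monomial_circle m)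

variable (ι) in
/-- The trigonometric polynomials on a product of circles. -/
noncomputable def trigPolynomials : StarSubalgebra ℂ C(ι → Circle, ℂ) where
  toSubalgebra := Algebra.adjoin ℂ (Set.range monomialFun)
  star_mem' := by
    change Algebra.adjoin ℂ (Set.range monomialFun) ≤
      star (Algebra.adjoin ℂ (Set.range (monomialFun (ι := ι))))
    refine Algebra.adjoin_le ?_
    rintro _ ⟨m, rfl⟩
    refine Algebra.subset_adjoin ⟨-m, ?_⟩
    ext y
    simp [monomialFun, ← Circle.coe_inv_eq_conj]

/-- Products of monomials are monomials, so linear functionals need only be compared on these. -/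
theorem trigPolynomials_toSubmodule :
    Subalgebra.toSubmodule (trigPolynomials ι).toSubalgebra =
      Submodule.span ℂ (Set.range monomialFun) := by
  refine Algebra.adjoin_eq_span_of_subset _ ?_
  refine subset_trans ?_ Submodule.subset_span
  intro f hf
  induction hf using Submonoid.closure_induction with
  | mem f hf => exact hf
  | one => exact ⟨0, by ext y; simp [monomialFun]⟩
  | mul f g _ _ hf hg =>
    obtain ⟨a, rfl⟩ := hf
    obtain ⟨b, rfl⟩ := hg
    exact ⟨a + b, by ext y; simp [monomialFun]⟩

theorem trigPolynomials_separatesPoints : (trigPolynomials ι).SeparatesPoints := by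
  intro y z hyz
  obtain ⟨i, hi⟩ := Function.ne_iff.mp hyz
  refine ⟨_, ⟨monomialFun (Finsupp.single i 1), Algebra.subset_adjoin ⟨_, rfl⟩, rfl⟩, ?_⟩
  simpa [monomialFun, monomial_single, Circle.coe_inj] using fun h => hi (Circle.ext h)

theorem dense_span_monomialFun :
    (Submodule.span ℂ (Set.range (monomialFun (ι := ι)))).topologicalClosure = ⊤ := by
  have h := ContinuousMap.starSubalgebra_topologicalClosure_eq_top_of_separatesPoints
    (trigPolynomials ι) trigPolynomials_separatesPoints
  rw [← trigPolynomials_toSubmodule]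
  refine SetLike.ext fun f => ?_
  have := SetLike.ext_iff.mp h f
  exact this

/-- Translating by `g` multiplies the integral by `γ g`, which can be chosen different from 1. -/
theorem integral_character_eq_zero [IsTopologicalGroup G] [MeasurableSpace G] [BorelSpace G]
    (μ : Measure G) [μ.IsMulLeftInvariant] {γ : PontryaginDual G} (hγ : γ ≠ 1) :
    ∫ x, (γ x : ℂ) ∂μ = 0 := by
  obtain ⟨g, hg⟩ : ∃ g, γ g ≠ 1 := by
    by_contra! h
    exact hγ (PontryaginDual.ext h)
  have h := integral_mul_left_eq_self (μ := μ) (fun x => (γ x : ℂ)) g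
  simp only [map_mul, Circle.coe_mul, integral_const_mul] at h
  have h1 : ((γ g : ℂ) - 1) * ∫ x, (γ x : ℂ) ∂μ = 0 := by rw [sub_mul, h, one_mul, sub_self]
  refine (mul_eq_zero.mp h1).resolve_left (sub_ne_zero.mpr ?_)
  exact fun h => hg (Circle.ext h)

variable [IsTopologicalGroup G] [CompactSpace G]

/-- Both sides are continuous and linear in `F`, so monomials suffice. There they differ by the
factor `monomial z m`, which is trivial by `hz` unless the integrated character is nontrivial and
both sides vanish. -/
theorem integral_translate_eq [MeasurableSpace G] [BorelSpace G] (μ : Measure G)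
    [IsFiniteMeasure μ] [μ.IsMulLeftInvariant] {f : ι → PontryaginDual G} {z : ι → Circle}
    (hz : ∀ m, monomial f m = 0 → monomial z m = 0) (F : C(ι → Circle, ℂ)) :
    ∫ x, F (fun i => z i * f i x) ∂μ = ∫ x, F (fun i => f i x) ∂μ := by
  have hcont (y : ι → Circle) : Continuous fun x : G => (fun i => y i * f i x) :=
    continuous_pi fun i => continuous_const.mul (map_continuous (f i))
  have hint (y : ι → Circle) (F : C(ι → Circle, ℂ)) :
      Integrable (fun x : G => F (fun i => y i * f i x)) μ :=
    (F.continuous.comp (hcont y)).integrable_of_hasCompactSupport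
      (HasCompactSupport.of_compactSpace _)
  let L (y : ι → Circle) : C(ι → Circle, ℂ) →L[ℂ] ℂ :=
    LinearMap.mkContinuous
      { toFun := fun F => ∫ x, F (fun i => y i * f i x) ∂μ
        map_add' := fun F₁ F₂ => integral_add (hint y F₁) (hint y F₂)
        map_smul' := fun c F => integral_const_mul c _ }
      (μ.real Set.univ) fun F => by
        rw [mul_comm]
        exact norm_integral_le_of_norm_le_const (.of_forall fun x => F.norm_coe_le_norm _)
  have hL : L z = L 1 := by
    refine ContinuousLinearMap.ext_on
      (s := Set.range (monomialFun (ι := ι))) ?_ ?_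
    · exact Submodule.dense_iff_topologicalClosure_eq_top.mpr dense_span_monomialFun
    · rintro _ ⟨m, rfl⟩
      have key (y : ι → Circle) : L y (monomialFun m) =
          ((monomial y m).toMul : Circle) * ∫ x, ((monomial f m).toMul x : ℂ) ∂μ := by
        rw [← integral_const_mul]
        refine integral_congr_ae (.of_forall fun x => ?_)
        simp [monomialFun, monomial_mul, monomial_dual_apply]
      rw [key, key]
      by_cases hm : monomial f m = 0
      · have h1 : monomial (1 : ι → Circle) m = 0 :=
          monomial_eq_zero_of_pow (N := 1) (fun i => by simp) (by simp)
        rw [hz m hm, h1]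
      · rw [integral_character_eq_zero μ (γ := (monomial f m).toMul) hm, mul_zero, mul_zero]
  simpa [L] using DFunLike.congr_fun hL F

/-- A family of values in the circle that satisfies all multiplicative relations among a family of
characters of a compact abelian group is attained by these characters at a point. -/
theorem exists_forall_eq_apply {f : ι → PontryaginDual G} {z : ι → Circle}
    (hz : ∀ m, monomial f m = 0 → monomial z m = 0) : ∃ x : G, ∀ i, z i = f i x := by
  by_contra hcon
  have hev : Continuous fun x : G => (fun i => f i x) :=
    continuous_pi fun i => map_continuous (f i)
  -- `u` vanishes on the compact image of `G` but is 1 at the missed point `z`: its integral over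
  -- the image is 0, over the translate by `z` positive.
  obtain ⟨u, hu0, hu1, hu⟩ := exists_continuous_zero_one_of_isClosed
    (isCompact_range hev).isClosed (isClosed_singleton (x := z))
    (Set.disjoint_singleton_right.mpr fun ⟨x, hx⟩ => hcon ⟨x, fun i => (congrFun hx i).symm⟩)
  let : MeasurableSpace G := borel G
  have : BorelSpace G := ⟨rfl⟩
  let μ : Measure G := Measure.haar
  let F : C(ι → Circle, ℂ) := ⟨fun y => (u y : ℂ), by fun_prop⟩
  have h := integral_translate_eq μ hz F
  have hrhs : ∫ x, F (fun i => f i x) ∂μ = 0 := by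
    refine (integral_congr_ae (.of_forall fun x => ?_)).trans (integral_zero G ℂ)
    simpa [F] using hu0 ⟨x, rfl⟩
  have hpos : 0 < ∫ x, u (fun i => z i * f i x) ∂μ := by
    refine Continuous.integral_pos_of_hasCompactSupport_nonneg_nonzero (x := 1) ?_
      (HasCompactSupport.of_compactSpace _) (fun x => (hu _).1) ?_
    · exact u.continuous.comp
        (continuous_pi fun i => continuous_const.mul (map_continuous (f i)))
    · have : u z = 1 := hu1 rfl
      simp [this]
  rw [hrhs] at h
  have h' : ((∫ x, u (fun i => z i * f i x) ∂μ : ℝ) : ℂ) = 0 := by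
    rw [← integral_complex_ofReal]; exact h
  exact hpos.ne' (by exact_mod_cast h')

theorem exists_circle_pow_eq_one_and_dvd {N : ℕ} (hN : N ≠ 0) :
    ∃ ζ : Circle, ζ ^ N = 1 ∧ ∀ k : ℤ, ζ ^ k = 1 → (N : ℤ) ∣ k := by
  have hN' : (N : ℝ) ≠ 0 := by exact_mod_cast hN
  refine ⟨Circle.exp (2 * Real.pi / N), ?_, fun k hk => ?_⟩
  · rw [← Circle.exp_nsmul, nsmul_eq_mul, mul_div_cancel₀ _ hN', Circle.exp_two_pi]
  · rw [← Circle.exp_zsmul, Circle.exp_eq_one] at hk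
    obtain ⟨n, hn⟩ := hk
    refine ⟨n, ?_⟩
    rw [zsmul_eq_mul] at hn
    field_simp at hn
    exact_mod_cast hn

theorem relationsDivisible_iff_forall_exists {N : ℕ} (hN : N ≠ 0) {f : ι → PontryaginDual G} :
    RelationsDivisible N f ↔
      ∀ φ : ι → Circle, (∀ i, φ i ^ N = 1) → ∃ x : G, ∀ i, φ i = f i x := by
  classical
  refine ⟨fun h φ hφ => exists_forall_eq_apply fun m hm =>
    monomial_eq_zero_of_pow hφ (h m hm), fun h m hm i => ?_⟩
  obtain ⟨ζ, hζ, hdvd⟩ := exists_circle_pow_eq_one_and_dvd hN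
  -- At such an `x` the relation reduces to `ζ ^ m i = 1`.
  obtain ⟨x, hx⟩ := h (fun j => if j = i then ζ else 1)
    (fun j => by split_ifs <;> simp [hζ])
  refine hdvd _ ?_
  have h1 : (monomial (fun j => f j x) m).toMul = 1 := by
    rw [← monomial_dual_apply, hm]; rfl
  simp_rw [← hx] at h1
  rw [← h1]
  simp only [monomial, Finsupp.linearCombination_apply, Finsupp.sum, toMul_sum, toMul_zsmul,
    toMul_ofMul]
  by_cases hi : i ∈ m.support
  · rw [Finset.prod_eq_single_of_mem i hi (fun j _ hj => by simp [hj])]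
    simp
  · rw [Finsupp.notMem_support_iff.mp hi, zpow_zero]
    refine (Finset.prod_eq_one fun j hj => ?_).symm
    rw [if_neg (by rintro rfl; exact hi hj), one_zpow]

theorem isPR_iff_relationsDivisible {N : ℕ} (hN : N ≠ 0) {E : Set (PontryaginDual G)} :
    IsPR N E ↔ RelationsDivisible N (Subtype.val : E → PontryaginDual G) :=
  (relationsDivisible_iff_forall_exists hN).symm

end Compact

/-- The embedding `q ↦ exp (2 π i q)` of `ℚ / ℤ` into the circle. -/
noncomputable def ratCircleHom : AddCircle (1 : ℚ) →+ Additive Circle :=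
  QuotientAddGroup.lift _
    (Circle.expHom.comp ((AddMonoidHom.mulLeft (2 * Real.pi)).comp
      (Rat.castHom ℝ).toAddMonoidHom)) <| by
    rw [AddSubgroup.zmultiples_le]
    exact congrArg Additive.ofMul ((congrArg Circle.exp (by simp)).trans Circle.exp_two_pi)

theorem ratCircleHom_injective : Function.Injective ratCircleHom := by
  refine (injective_iff_map_eq_zero _).mpr fun a ha => ?_
  induction a using QuotientAddGroup.induction_on with
  | H q =>
    have h : Circle.exp (2 * Real.pi * (q : ℝ)) = 1 := ha
    obtain ⟨n, hn⟩ := Circle.exp_eq_one.mp h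
    rw [mul_comm] at hn
    have hq : (q : ℝ) = n := mul_right_cancel₀ Real.two_pi_pos.ne' hn
    refine (QuotientAddGroup.eq_zero_iff q).mpr ⟨n, ?_⟩
    have hq' : q = n := by exact_mod_cast hq
    simp [hq']

theorem exists_monoidHom_circle_apply_ne_one {A : Type*} [CommGroup A] {a : A} (ha : a ≠ 1) :
    ∃ χ : A →* Circle, χ a ≠ 1 := by
  obtain ⟨c, hc⟩ := CharacterModule.exists_character_apply_ne_zero_of_ne_zero
    (A := Additive A) (a := Additive.ofMul a) ha
  refine ⟨MonoidHom.toAdditive.symm (ratCircleHom.comp c), fun h => hc ?_⟩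
  exact ratCircleHom_injective (h.trans (map_zero ratCircleHom).symm)

/-! ### Transfer to discrete groups and their biduals -/

section Discrete

variable {Γ : Type*} [CommGroup Γ] [TopologicalSpace Γ]

/-- `evalChar` as a homomorphism. -/
noncomputable def evalCharHom (Γ : Type*) [CommGroup Γ] [TopologicalSpace Γ] :
    Γ →* PontryaginDual (PontryaginDual Γ) where
  toFun := evalChar Γ
  map_one' := PontryaginDual.ext fun x => map_one x
  map_mul' a b := PontryaginDual.ext fun x => map_mul x a b

variable [DiscreteTopology Γ]

theorem evalCharHom_injective : Function.Injective (evalCharHom Γ) := by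
  refine (injective_iff_map_eq_one _).mpr fun a ha => ?_
  by_contra hne
  obtain ⟨χ, hχ⟩ := exists_monoidHom_circle_apply_ne_one hne
  let ψ : PontryaginDual Γ := (⟨χ, continuous_of_discreteTopology⟩ : Γ →ₜ* Circle)
  exact hχ (DFunLike.congr_fun ha ψ)

theorem isPRInDiscrete_iff_relationsDivisible {N : ℕ} (hN : N ≠ 0) {E : Set Γ} :
    IsPRInDiscrete N E ↔ RelationsDivisible N (Subtype.val : E → Γ) := by
  refine (isPR_iff_relationsDivisible hN).trans ?_
  refine (relationsDivisible_image (g := evalCharHom Γ) evalCharHom_injective.injOn).trans ?_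
  exact relationsDivisible_comp_hom _ evalCharHom_injective

end Discrete

/-- The image set forgets repetitions in the family; injectivity is exactly what rules them out, and
for `N ≠ 1` the family condition implies it. -/
theorem isPRInDiscrete_image_and_injOn_iff {α Δ : Type*} [CommGroup Δ] [TopologicalSpace Δ]
    [DiscreteTopology Δ] {N : ℕ} (hN : N ≠ 0) (hN1 : N ≠ 1) {E : Set α} {g : α → Δ} :
    IsPRInDiscrete N (g '' E) ∧ Set.InjOn g E ↔ RelationsDivisible N (fun a : E => g a) := by
  rw [isPRInDiscrete_iff_relationsDivisible hN]
  refine ⟨fun h => (relationsDivisible_image h.2).mp h.1, fun h => ?_⟩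
  have hinj : Set.InjOn g E := Set.injOn_iff_injective.mpr (h.injective hN1)
  exact ⟨(relationsDivisible_image hinj).mpr h, hinj⟩

end PseudoRademacher

theorem mainTheorem6 {G : Type*} [CommGroup G] [TopologicalSpace G] [IsTopologicalGroup G]
    [CompactSpace G] [T2Space G] (E : Set (PontryaginDual G)) (p n : ℕ) (hp : p.Prime)
    (hn : 1 ≤ n) :
    List.TFAE
      [PseudoRademacher.IsPR (p ^ n) E,
        ∀ (k : ℕ) (hk : 1 ≤ k), k ≤ n →
          PseudoRademacher.IsPRInDiscrete (p ^ (n + 1 - k))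
              (PseudoRademacher.primePowProj (PontryaginDual G) p k hp hk '' E) ∧
            Set.InjOn (PseudoRademacher.primePowProj (PontryaginDual G) p k hp hk) E,
        ∃ (k : ℕ) (hk : 1 ≤ k), k ≤ n ∧
          PseudoRademacher.IsPRInDiscrete (p ^ (n + 1 - k))
              (PseudoRademacher.primePowProj (PontryaginDual G) p k hp hk '' E) ∧
            Set.InjOn (PseudoRademacher.primePowProj (PontryaginDual G) p k hp hk) E] := by
  have hne (j : ℕ) : p ^ j ≠ 0 := pow_ne_zero j hp.ne_zero
  have hne1 {k : ℕ} (hkn : k ≤ n) : p ^ (n + 1 - k) ≠ 1 :=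
    (Nat.one_lt_pow (by omega) hp.one_lt).ne'
  tfae_have 1 → 2 := fun h k hk hkn =>
    (PseudoRademacher.isPRInDiscrete_image_and_injOn_iff (hne _) (hne1 hkn)).mpr
      (((PseudoRademacher.isPR_iff_relationsDivisible (hne n)).mp h).comp_primePowProj hp hk)
  tfae_have 2 → 3 := fun h => ⟨1, le_rfl, hn, h 1 le_rfl hn⟩
  tfae_have 3 → 1 := by
    rintro ⟨k, hk, hkn, h⟩
    rw [PseudoRademacher.isPRInDiscrete_image_and_injOn_iff (hne _) (hne1 hkn)] at h
    exact (PseudoRademacher.isPR_iff_relationsDivisible (hne n)).mpr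
      (PseudoRademacher.RelationsDivisible.of_comp_primePowProj hp hk hkn h)
  tfae_finish
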